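/- Let $(X,\mathcal F)$ be a measurable space, let $m$ be a natural number and let $\mu=(\mu_1,\dots,\mu_m)$ be a finite vector measure on it, that is, each $\mu_i:\mathcal F\to\mathbb R$ is a finite (possibly signed) countably additive measure. For $Y\in\mathcal F$ let $R_\mu(Y)=\{\mu(Z): Z\in\mathcal F,\ Z\subseteq Y\}\subseteq\mathbb R^m$, and for $p\in\mathbb R^m$ let $$R^p_\mu(X)=\bigcup_{Y\in\mathcal F,\ \mu(Y)=p}R_\mu(Y).$$ Call $\mu$ atomless if, for every $i$, each $Z\in\mathcal F$ with $\mu_i(Z)\neq 0$ has a subset $Z'\in\mathcal F$ with $\mu_i(Z')\neq0$ and $\mu_i(Z')\neq\mu_i(Z)$ (for a nonnegative $\mu_i$: each $Z\in\mathcal F$ with $\mu_i(Z)>0$ has a subset $Z'\in\mathcal F$ with $0<\mu_i(Z')<\mu_i(Z)$). Then for every $p\in R_\mu(X)$ the set $R^p_\mu(X)$ is compact and, if $\mu$ is atomless, it is also convex. Moreover $R^{\mu(X)}_\mu(X)=R_\mu(X)$, so that the case $p=\mu(X)$ is Lyapunov's convexity theorem: $R_\mu(X)$ is compact and, if $\mu$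 is atomless, convex. -/

import Mathlib

open MeasureTheory Set

namespace VecMeas

variable {X : Type*} [MeasurableSpace X] {m : ℕ}

/-- The value `μ(Z) = (μ₁(Z), …, μₘ(Z)) ∈ ℝᵐ` of a finite vector measure `μ = (μ₁, …, μₘ)`, whose
components are finite, possibly signed, countably additive measures. -/
def val (μ : Fin m → SignedMeasure X) (Z : Set X) : Fin m → ℝ :=
  fun i => μ i Z

/-- The range `R_μ(Y) = {μ(Z) : Z measurable, Z ⊆ Y}`. -/
def range (μ : Fin m → SignedMeasure X) (Y : Set X) : Set (Fin m → ℝ) :=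
  {q | ∃ Z : Set X, MeasurableSet Z ∧ Z ⊆ Y ∧ val μ Z = q}

/-- The family `S^p_μ(X)` of all measurable sets `Y` with `μ(Y) = p`. -/
def level (μ : Fin m → SignedMeasure X) (p : Fin m → ℝ) : Set (Set X) :=
  {Y | MeasurableSet Y ∧ val μ Y = p}

/-- The subrange `R^p_μ(X)`: the union of the ranges `R_μ(Y)` over all measurable `Y` with
`μ(Y) = p`. -/
def subrange (μ : Fin m → SignedMeasure X) (p : Fin m → ℝ) : Set (Fin m → ℝ) :=
  ⋃ Y ∈ level μ p, range μ Y

/-- A finite signed measure `ν` is atomless if every measurable `Z` with `ν(Z) ≠ 0` has a measurable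
subset `Z'` with `ν(Z') ≠ 0` and `ν(Z') ≠ ν(Z)`. For a nonnegative `ν` this says that every
measurable `Z` with `ν(Z) > 0` has a measurable subset `Z'` with `0 < ν(Z') < ν(Z)`. -/
def AtomlessSigned (ν : SignedMeasure X) : Prop :=
  ∀ Z : Set X, MeasurableSet Z → ν Z ≠ 0 →
    ∃ Z' : Set X, MeasurableSet Z' ∧ Z' ⊆ Z ∧ ν Z' ≠ 0 ∧ ν Z' ≠ ν Z

/-- A vector measure is atomless if each of its components is. -/
def Atomless (μ : Fin m → SignedMeasure X) : Prop :=
  ∀ i, AtomlessSigned (μ i)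

end VecMeas

/-!
A point of the subrange `R^p_μ(X)` is `μ(Z)` for a disjoint pair of measurable sets `Z`, `W` with
`μ(Z) + μ(W) = p` (`mem_subrange_iff`), that is, for a measurable partition of `X` into `Z`, `W` and the
rest. As in Lindenstrauss's proof of Lyapunov's theorem, partitions are relaxed to partitions of unity
`f 0 + f 1 + f 2 = 1`, and the proof shows that the relaxation attains no new values.

Let `λ` be the sum of the total variations of the components (`refMeasure`); each `μ i` has a bounded
density `h i` with respect to `λ`. A relaxed partition is a triple of functions in `L²(λ)`, seen as
functionals, that are nonnegative, sum to one, and have mean `0` or `1` on each atom of `λ`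
(`relaxedPartitions`). The last condition is what makes the argument work in the presence of atoms
without splitting them off. All three conditions are weak-* closed, so the relaxed partitions form a
compact set by Banach-Alaoglu (`isCompact_relaxedPartitions`); if `λ` has no atoms, which is so when `μ`
is atomless (`Atomless.not_isMassAtom`), the set is also convex (`convex_relaxedPartitions`).

The relaxed partitions with given moments `∫ f j * h i dλ` form a compact set, so by the Krein-Milman
lemma it has an extreme point. There the `f j` are indicator functions (`null_of_extreme`,
`exists_disjoint_sets`): if two of them were bounded below by `ε` on a nonnull set `E`, then `E` would
contain no atom, so there would be a nonzero function on `E`, bounded by `ε` and orthogonal to every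
`h i`, which could be added to one and subtracted from the other, and conversely.

Hence `R^p_μ(X)` is the image, under a continuous linear map, of the set of relaxed partitions that
satisfy the closed affine condition `∫ (f 0 + f 1) * h i dλ = p i` (`subrange_eq_image`), and inherits
compactness and convexity from it.
-/

namespace VecMeas

open scoped RealInnerProductSpace

/-! ### Atoms of a finite measure -/

section Atoms

variable {X : Type*} [MeasurableSpace X]

/-- A measurable set of nonzero measure whose measurable subsets are either null or of full
measure. -/
def IsMassAtom (lam : Measure X) (A : Set X) : Prop :=
  MeasurableSet A ∧ lam A ≠ 0 ∧ ∀ B ⊆ A, MeasurableSet B → lam B = 0 ∨ lam B = lam A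

/-- A set that contains no atom is not charged by any atom: otherwise its intersection with the atom
would itself be an atom. -/
theorem IsMassAtom.inter_null {lam : Measure X} {A E : Set X} (hA : IsMassAtom lam A)
    (hE : MeasurableSet E) (hno : ∀ B ⊆ E, ¬ IsMassAtom lam B) : lam (E ∩ A) = 0 := by
  by_contra h0
  refine hno (E ∩ A) inter_subset_left ⟨hE.inter hA.1, h0, fun B hB hBm => ?_⟩
  have h1 := (hA.2.2 (E ∩ A) inter_subset_right (hE.inter hA.1)).resolve_left h0
  rw [h1]
  exact hA.2.2 B (hB.trans inter_subset_right) hBm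

theorem exists_disjoint_pos_subsets {lam : Measure X} [IsFiniteMeasure lam] (n : ℕ) :
    ∀ E : Set X, MeasurableSet E → lam E ≠ 0 → (∀ B ⊆ E, ¬ IsMassAtom lam B) →
      ∃ s : Fin n → Set X, (∀ l, MeasurableSet (s l) ∧ s l ⊆ E ∧ lam (s l) ≠ 0) ∧
        Pairwise (Function.onFun Disjoint s) := by
  induction n with
  | zero => exact fun E _ _ _ => ⟨fun l => l.elim0, fun l => l.elim0, fun l => l.elim0⟩
  | succ n ih =>
    intro E hE h0 hno
    obtain ⟨B, hBE, hB, hB0, hB1⟩ : ∃ B ⊆ E, MeasurableSet B ∧ lam B ≠ 0 ∧ lam B ≠ lam E := by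
      by_contra! h
      exact hno E subset_rfl ⟨hE, h0, fun B hB hBm => or_iff_not_imp_left.2 (h B hB hBm)⟩
    have hd : lam (E \ B) ≠ 0 := by
      intro h
      apply hB1
      have := measure_sdiff_add_inter (μ := lam) E hB
      rw [h, zero_add, inter_eq_self_of_subset_right hBE] at this
      exact this
    obtain ⟨s, hs, hdisj⟩ := ih (E \ B) (hE.diff hB) hd
      fun C hC => hno C (hC.trans sdiff_subset)
    refine ⟨Fin.cons B s, ?_, ?_⟩
    · intro l
      refine Fin.cases ?_ (fun l => ?_) l
      · exact ⟨hB, hBE, hB0⟩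
      · exact ⟨(hs l).1, (hs l).2.1.trans sdiff_subset, (hs l).2.2⟩
    · have key : ∀ l, Disjoint B (s l) := fun l =>
        disjoint_sdiff_right.mono_right (hs l).2.1
      intro a b
      refine Fin.cases ?_ (fun a => ?_) a <;> refine Fin.cases ?_ (fun b => ?_) b
      · intro h; exact absurd rfl h
      · intro _; exact key b
      · intro _; exact (key a).symm
      · intro h; exact hdisj fun hab => h (congrArg Fin.succ hab)

end Atoms

/-! ### Relaxed partitions -/

section Relaxation

variable {X : Type*} [MeasurableSpace X] (lam : Measure X)

/-- Triples of functionals on `L²`, with the product of the weak-* topologies. -/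
abbrev Triple : Type _ := Fin 3 → WeakDual ℝ (Lp ℝ 2 lam)

instance : LocallyConvexSpace ℝ (WeakDual ℝ (Lp ℝ 2 lam)) :=
  inferInstanceAs (LocallyConvexSpace ℝ (WeakBilin _))

instance : LocallyConvexSpace ℝ (Triple lam) :=
  LocallyConvexSpace.iInf fun i => LocallyConvexSpace.induced
    (LinearMap.proj i : Triple lam →ₗ[ℝ] WeakDual ℝ (Lp ℝ 2 lam))

/-- The functional `⟪f, ·⟫`, as an element of the dual of `L²` with its weak-* topology. -/
noncomputable def innerDual (f : Lp ℝ 2 lam) : WeakDual ℝ (Lp ℝ 2 lam) :=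
  StrongDual.toWeakDual (InnerProductSpace.toDual ℝ _ f)

@[simp] theorem innerDual_apply (f g : Lp ℝ 2 lam) : innerDual lam f g = ⟪f, g⟫ := rfl

theorem exists_eq_innerDual (φ : WeakDual ℝ (Lp ℝ 2 lam)) : ∃ f, φ = innerDual lam f := by
  obtain ⟨f, hf⟩ := (InnerProductSpace.toDual ℝ (Lp ℝ 2 lam)).surjective (WeakDual.toStrongDual φ)
  exact ⟨f, by rw [innerDual, hf]; rfl⟩

variable {lam} in
theorem continuous_eval (j : Fin 3) (g : Lp ℝ 2 lam) :
    Continuous fun φ : Triple lam => φ j g :=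
  (WeakDual.eval_continuous g).comp (continuous_apply j)

variable [IsFiniteMeasure lam]

/-- The indicator function of a measurable set as an element of `L²`. -/
noncomputable def ind {s : Set X} (hs : MeasurableSet s) : Lp ℝ 2 lam :=
  indicatorConstLp 2 hs (measure_ne_top lam s) (1 : ℝ)

theorem inner_ind {s : Set X} (hs : MeasurableSet s) (f : Lp ℝ 2 lam) :
    ⟪ind lam hs, f⟫ = ∫ x in s, f x ∂lam :=
  L2.inner_indicatorConstLp_one hs (measure_ne_top lam s) f

theorem inner_ind_right {s : Set X} (hs : MeasurableSet s) (f : Lp ℝ 2 lam) :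
    ⟪f, ind lam hs⟫ = ∫ x in s, f x ∂lam := by
  rw [real_inner_comm, inner_ind]

theorem inner_ind_ind {s t : Set X} (hs : MeasurableSet s) (ht : MeasurableSet t) :
    ⟪ind lam hs, ind lam ht⟫ = lam.real (s ∩ t) :=
  L2.real_inner_indicatorConstLp_one_indicatorConstLp_one hs ht

/-- Relaxed partitions of `X` into three measurable sets. Through the Riesz representation, `φ` stands
for a triple of functions `0 ≤ f j` with `f 0 + f 1 + f 2 = 1` almost everywhere, subject to the
condition that on every atom of `lam` each `f j` has mean `0` or `1`. The conditions are all written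
as conditions on values `φ j (ind lam hs)`, so that they are weak-* closed by inspection. -/
def relaxedPartitions : Set (Triple lam) :=
  {φ | (∀ (s : Set X) (hs : MeasurableSet s) (j : Fin 3), 0 ≤ φ j (ind lam hs)) ∧
    (∀ (s : Set X) (hs : MeasurableSet s), ∑ j, φ j (ind lam hs) = lam.real s) ∧
    ∀ (A : Set X) (hA : IsMassAtom lam A) (j : Fin 3),
      φ j (ind lam hA.1) = 0 ∨ φ j (ind lam hA.1) = lam.real A}

variable {lam}

/-- The functions represented by a relaxed partition form a partition of unity. -/
theorem exists_densities {φ : Triple lam} (hφ : φ ∈ relaxedPartitions lam) :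
    ∃ f : Fin 3 → Lp ℝ 2 lam, (∀ j, φ j = innerDual lam (f j)) ∧
      (∀ᵐ x ∂lam, ∀ j, 0 ≤ f j x) ∧ ∀ᵐ x ∂lam, ∑ j, f j x = 1 := by
  choose f hf using fun j => exists_eq_innerDual lam (φ j)
  have hint : ∀ j, Integrable (f j) lam := fun j => (Lp.memLp (f j)).integrable one_le_two
  have hset : ∀ j (s : Set X) (hs : MeasurableSet s), φ j (ind lam hs) = ∫ x in s, f j x ∂lam :=
    fun j s hs => by rw [hf, innerDual_apply, inner_ind_right]
  refine ⟨f, hf, ?_, ?_⟩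
  · rw [ae_all_iff]
    intro j
    refine ae_nonneg_of_forall_setIntegral_nonneg (hint j) fun s hs _ => ?_
    rw [← hset j s hs]
    exact hφ.1 s hs j
  · refine Integrable.ae_eq_of_forall_setIntegral_eq _ _ (integrable_finsetSum _ fun j _ => hint j)
      (integrable_const 1) fun s hs _ => ?_
    rw [integral_finsetSum _ fun j _ => (hint j).integrableOn]
    simp only [← hset _ s hs, hφ.2.1 s hs]
    simp

theorem isClosed_relaxedPartitions : IsClosed (relaxedPartitions lam) := by
  simp only [relaxedPartitions, ofPred_and, ofPred_forall, ofPred_or]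
  refine IsClosed.inter ?_ (IsClosed.inter ?_ ?_)
  · exact isClosed_iInter fun s => isClosed_iInter fun hs => isClosed_iInter fun j =>
      isClosed_le continuous_const (continuous_eval j _)
  · exact isClosed_iInter fun s => isClosed_iInter fun hs =>
      isClosed_eq (continuous_finsetSum _ fun j _ => continuous_eval j _) continuous_const
  · exact isClosed_iInter fun A => isClosed_iInter fun hA => isClosed_iInter fun j =>
      (isClosed_eq (continuous_eval j _) continuous_const).union
        (isClosed_eq (continuous_eval j _) continuous_const)

/-- Banach-Alaoglu: the represented functions take values in `[0, 1]`, so the functionals have bounded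
norm. -/
theorem isCompact_relaxedPartitions : IsCompact (relaxedPartitions lam) := by
  obtain ⟨R, hR⟩ : ∃ R : ℝ, ∀ φ ∈ relaxedPartitions lam, ∀ j,
      ‖WeakDual.toStrongDual (φ j)‖ ≤ R := by
    refine ⟨(measureUnivNNReal lam : ℝ) ^ (2 : ENNReal).toReal⁻¹ * 1, fun φ hφ j => ?_⟩
    obtain ⟨f, hf, h0, h1⟩ := exists_densities hφ
    have : ‖WeakDual.toStrongDual (φ j)‖ = ‖f j‖ := by
      rw [hf]; exact (InnerProductSpace.toDual ℝ (Lp ℝ 2 lam)).norm_map (f j)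
    rw [this]
    refine Lp.norm_le_of_ae_bound zero_le_one ?_
    filter_upwards [h0, h1] with x hx0 hx1
    rw [Real.norm_of_nonneg (hx0 j), ← hx1]
    exact Finset.single_le_sum (f := fun j => f j x) (fun k _ => hx0 k) (Finset.mem_univ j)
  refine IsCompact.of_isClosed_subset
    (isCompact_univ_pi fun _ => WeakDual.isCompact_closedBall (𝕜 := ℝ) (E := Lp ℝ 2 lam) 0 R)
    isClosed_relaxedPartitions fun φ hφ j _ => ?_
  rw [mem_preimage, mem_closedBall_zero_iff]
  exact hR φ hφ j

/-- The condition on atoms is the only one that is not convex. -/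
theorem convex_relaxedPartitions (hno : ∀ A, ¬ IsMassAtom lam A) :
    Convex ℝ (relaxedPartitions lam) := by
  intro φ hφ ψ hψ a b ha hb hab
  refine ⟨fun s hs j => ?_, fun s hs => ?_, fun A hA => absurd hA (hno A)⟩
  · have h1 := hφ.1 s hs j
    have h2 := hψ.1 s hs j
    change 0 ≤ a * φ j (ind lam hs) + b * ψ j (ind lam hs)
    positivity
  · change ∑ j, (a * φ j (ind lam hs) + b * ψ j (ind lam hs)) = _
    rw [Finset.sum_add_distrib, ← Finset.mul_sum, ← Finset.mul_sum, hφ.2.1, hψ.2.1, ← add_mul,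
      hab, one_mul]

theorem indicator_mem_relaxedPartitions {s : Fin 3 → Set X} (hs : ∀ j, MeasurableSet (s j))
    (hdisj : Pairwise (Function.onFun Disjoint s)) (hU : ⋃ j, s j = univ) :
    (fun j => innerDual lam (ind lam (hs j))) ∈ relaxedPartitions lam := by
  refine ⟨fun t ht j => ?_, fun t ht => ?_, fun A hA j => ?_⟩
  · rw [innerDual_apply, inner_ind_ind]
    exact measureReal_nonneg
  · simp only [innerDual_apply, inner_ind_ind]
    rw [← measureReal_iUnion_fintype
      (fun a b hab => (hdisj hab).mono inter_subset_left inter_subset_left)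
      (fun j => (hs j).inter ht), ← iUnion_inter, hU, univ_inter]
  · rw [innerDual_apply, inner_ind_ind]
    refine (hA.2.2 (s j ∩ A) inter_subset_right ((hs j).inter hA.1)).imp (fun h => ?_) fun h => ?_
    · simp [measureReal_def, h]
    · simp [measureReal_def, h]

/-- The relaxed partitions that have the same moments against all `h i` as `φ`. -/
def fiber {ι : Type*} (h : ι → Lp ℝ 2 lam) (φ : Triple lam) : Set (Triple lam) :=
  {ψ | ψ ∈ relaxedPartitions lam ∧ ∀ i j, ψ j (h i) = φ j (h i)}

theorem isCompact_fiber {ι : Type*} (h : ι → Lp ℝ 2 lam) (φ : Triple lam) :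
    IsCompact (fiber h φ) := by
  have : fiber h φ = relaxedPartitions lam ∩ ⋂ i, ⋂ j, {ψ | ψ j (h i) = φ j (h i)} := by
    ext ψ
    simp [fiber]
  rw [this]
  exact isCompact_relaxedPartitions.inter_right <| isClosed_iInter fun i => isClosed_iInter fun j =>
    isClosed_eq (continuous_eval j _) continuous_const

end Relaxation

/-! ### Extreme points of the fibres are partitions -/

section Extreme

variable {X : Type*} [MeasurableSpace X] {lam : Measure X} [IsFiniteMeasure lam]

/-- On a nonnull set `E` without atoms there is room for a small nonzero function that is orthogonal
to finitely many given ones: a combination of the indicators of more disjoint nonnull subsets of `E`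
than there are orthogonality conditions. The last clause says that it is supported on `E` and bounded
by `ε`, in the integrated form in which it is used. -/
theorem exists_annihilating_function {ι : Type*} [Finite ι] (h : ι → Lp ℝ 2 lam) {E : Set X}
    (hE : MeasurableSet E) (h0 : lam E ≠ 0) (hno : ∀ B ⊆ E, ¬ IsMassAtom lam B) {ε : ℝ}
    (hε : 0 < ε) :
    ∃ u : Lp ℝ 2 lam, u ≠ 0 ∧ (∀ i, ⟪u, h i⟫ = 0) ∧
      ∀ (s : Set X) (hs : MeasurableSet s), |⟪u, ind lam hs⟫| ≤ ε * lam.real (E ∩ s) := by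
  have := Fintype.ofFinite ι
  obtain ⟨s, hs, hdisj⟩ := exists_disjoint_pos_subsets (Fintype.card ι + 1) E hE h0 hno
  obtain ⟨a, ha, ha0⟩ := Submodule.exists_mem_ne_zero_of_ne_bot
    (LinearMap.ker_ne_bot_of_finrank_lt
      (f := Fintype.linearCombination ℝ fun l i => ⟪ind lam (hs l).1, h i⟫)
      (by simp))
  -- `‖a‖` is the sup norm, so rescaling by `ε / ‖a‖` bounds each coefficient by `ε`.
  have hnorm : 0 < ‖a‖ := norm_pos_iff.2 ha0
  set b : Fin (Fintype.card ι + 1) → ℝ := (ε / ‖a‖) • a with hb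
  have hbε : ∀ l, |b l| ≤ ε := fun l => by
    have := norm_le_pi_norm a l
    rw [Real.norm_eq_abs] at this
    rw [hb, Pi.smul_apply, smul_eq_mul, abs_mul, abs_of_pos (by positivity), div_mul_eq_mul_div,
      div_le_iff₀ hnorm]
    gcongr
  have hb0 : b ≠ 0 := smul_ne_zero (by positivity) ha0
  have hbsum : ∀ i, ∑ l, b l * ⟪ind lam (hs l).1, h i⟫ = 0 := fun i => by
    have h1 := congrFun (LinearMap.mem_ker.1 ha) i
    rw [Fintype.linearCombination_apply, Finset.sum_apply] at h1
    simp only [Pi.smul_apply, smul_eq_mul, Pi.zero_apply] at h1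
    simp only [hb, Pi.smul_apply, smul_eq_mul, mul_assoc]
    rw [← Finset.mul_sum, h1, mul_zero]
  have hu : ∀ g, ⟪∑ l, b l • ind lam (hs l).1, g⟫ = ∑ l, b l * ⟪ind lam (hs l).1, g⟫ := fun g => by
    rw [sum_inner]
    exact Finset.sum_congr rfl fun l _ => real_inner_smul_left _ _ _
  refine ⟨∑ l, b l • ind lam (hs l).1, fun hzero => hb0 (funext fun k => ?_), fun i => ?_,
    fun t ht => ?_⟩
  · have h1 := hu (ind lam (hs k).1)
    rw [hzero, inner_zero_left, Finset.sum_eq_single k] at h1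
    · rw [inner_ind_ind, inter_self] at h1
      exact (mul_eq_zero.1 h1.symm).resolve_right
        ((measureReal_ne_zero_iff).2 (hs k).2.2)
    · intro l _ hl
      rw [inner_ind_ind, (hdisj hl).inter_eq, measureReal_empty, mul_zero]
    · simp
  · rw [hu, hbsum]
  · rw [hu]
    simp only [inner_ind_ind]
    calc |∑ l, b l * lam.real (s l ∩ t)| ≤ ∑ l, |b l * lam.real (s l ∩ t)| :=
          Finset.abs_sum_le_sum_abs _ _
      _ ≤ ∑ l, ε * lam.real (s l ∩ t) := by
          refine Finset.sum_le_sum fun l _ => ?_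
          rw [abs_mul, abs_of_nonneg measureReal_nonneg]
          exact mul_le_mul_of_nonneg_right (hbε l) measureReal_nonneg
      _ = ε * lam.real (⋃ l, s l ∩ t) := by
          rw [← Finset.mul_sum, measureReal_iUnion_fintype
            (fun a b hab => (hdisj hab).mono inter_subset_left inter_subset_left)
            (fun l => (hs l).1.inter ht)]
      _ ≤ ε * lam.real (E ∩ t) := by
          refine mul_le_mul_of_nonneg_left (measureReal_mono ?_) hε.le
          exact iUnion_subset fun l => inter_subset_inter_left _ (hs l).2.1

/-- Moving a mass distribution `u` that is orthogonal to all `h i` and to all atoms from the part `k` to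
the part `j` of a relaxed partition stays in the fibre, if `|u|` is dominated by both parts. -/
theorem mem_fiber_of_transfer {ι : Type*} {h : ι → Lp ℝ 2 lam} {φ ψ : Triple lam}
    (hψ : ψ ∈ fiber h φ) {j k : Fin 3} (hjk : j ≠ k) {u : Lp ℝ 2 lam} (hu : ∀ i, ⟪u, h i⟫ = 0)
    (huA : ∀ (A : Set X) (hA : IsMassAtom lam A), ⟪u, ind lam hA.1⟫ = 0)
    (hj : ∀ (s : Set X) (hs : MeasurableSet s), |⟪u, ind lam hs⟫| ≤ ψ j (ind lam hs))
    (hk : ∀ (s : Set X) (hs : MeasurableSet s), |⟪u, ind lam hs⟫| ≤ ψ k (ind lam hs)) :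
    ψ + (Pi.single j (innerDual lam u) - Pi.single k (innerDual lam u)) ∈ fiber h φ := by
  set δ : Triple lam := Pi.single j (innerDual lam u) - Pi.single k (innerDual lam u) with hδ
  have hδj : ∀ g, δ j g = ⟪u, g⟫ := fun g => by
    rw [hδ, Pi.sub_apply, Pi.single_eq_same, Pi.single_eq_of_ne hjk, sub_zero]; rfl
  have hδk : ∀ g, δ k g = -⟪u, g⟫ := fun g => by
    rw [hδ, Pi.sub_apply, Pi.single_eq_same, Pi.single_eq_of_ne hjk.symm, zero_sub]; rfl
  have hδl : ∀ l, l ≠ j → l ≠ k → ∀ g, δ l g = 0 := fun l h1 h2 g => by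
    rw [hδ, Pi.sub_apply, Pi.single_eq_of_ne h1, Pi.single_eq_of_ne h2, sub_zero]; rfl
  have hzero : ∀ g, ⟪u, g⟫ = 0 → ∀ l, δ l g = 0 := fun g hg l => by
    by_cases h1 : l = j
    · rw [h1, hδj, hg]
    by_cases h2 : l = k
    · rw [h2, hδk, hg, neg_zero]
    exact hδl l h1 h2 g
  have hadd : ∀ l g, (ψ + δ) l g = ψ l g + δ l g := fun l g => rfl
  refine ⟨⟨fun s hs l => ?_, fun s hs => ?_, fun A hA l => ?_⟩, fun i l => ?_⟩
  · rw [hadd]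
    by_cases h1 : l = j
    · rw [h1, hδj]; linarith [(abs_le.1 (hj s hs)).1]
    by_cases h2 : l = k
    · rw [h2, hδk]; linarith [(abs_le.1 (hk s hs)).2]
    rw [hδl l h1 h2, add_zero]
    exact hψ.1.1 s hs l
  · have : ∑ l, δ l (ind lam hs) = 0 := by
      rw [Finset.sum_eq_add_of_mem j k (Finset.mem_univ _) (Finset.mem_univ _) hjk
        fun l _ hl => hδl l hl.1 hl.2 _, hδj, hδk, add_neg_cancel]
    simp only [hadd]
    rw [Finset.sum_add_distrib, this, add_zero, hψ.1.2.1 s hs]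
  · rw [hadd, hzero _ (huA A hA) l, add_zero]
    exact hψ.1.2.2 A hA l
  · rw [hadd, hzero _ (hu i) l, add_zero]
    exact hψ.2 i l

/-- At an extreme point of a fibre two different parts cannot both be at least `ε` on a nonnull set
`E`. Such an `E` would contain no atom, since each part fills an atom entirely or not at all; hence
mass could be moved between the two parts, in both directions, within the fibre. -/
theorem null_of_extreme {ι : Type*} [Finite ι] {h : ι → Lp ℝ 2 lam} {φ ψ : Triple lam}
    (hψ : ψ ∈ (fiber h φ).extremePoints ℝ) {j k : Fin 3} (hjk : j ≠ k) {E : Set X}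
    (hE : MeasurableSet E) {ε : ℝ} (hε : 0 < ε)
    (hj : ∀ (s : Set X) (hs : MeasurableSet s), s ⊆ E → ε * lam.real s ≤ ψ j (ind lam hs))
    (hk : ∀ (s : Set X) (hs : MeasurableSet s), s ⊆ E → ε * lam.real s ≤ ψ k (ind lam hs)) :
    lam E = 0 := by
  by_contra h0
  have hmem := hψ.1
  have hno : ∀ B ⊆ E, ¬ IsMassAtom lam B := by
    intro B hB hA
    have hpos : 0 < lam.real B := lt_of_le_of_ne measureReal_nonneg
      (Ne.symm ((measureReal_ne_zero_iff).2 hA.2.1))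
    have hεB := mul_pos hε hpos
    -- Both parts fill the atom `B`, which they would have to share.
    have h1 := (hmem.1.2.2 B hA j).resolve_left (by linarith [hj B hA.1 hB])
    have h2 := (hmem.1.2.2 B hA k).resolve_left (by linarith [hk B hA.1 hB])
    have h3 : ∑ l ∈ {j, k}, ψ l (ind lam hA.1) ≤ ∑ l, ψ l (ind lam hA.1) :=
      Finset.sum_le_sum_of_subset_of_nonneg (Finset.subset_univ _) fun l _ _ => hmem.1.1 B hA.1 l
    rw [Finset.sum_pair hjk, hmem.1.2.1, h1, h2] at h3
    linarith
  obtain ⟨u, hu0, huh, hub⟩ := exists_annihilating_function h hE h0 hno hε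
  have hmono : ∀ (l : Fin 3) (s : Set X) (hs : MeasurableSet s),
      ψ l (ind lam (hE.inter hs)) ≤ ψ l (ind lam hs) := by
    obtain ⟨f, hf, hf0, -⟩ := exists_densities hmem.1
    intro l s hs
    rw [hf, innerDual_apply, innerDual_apply, inner_ind_right, inner_ind_right]
    refine setIntegral_mono_set ((Lp.memLp (f l)).integrable one_le_two).integrableOn
      (ae_restrict_of_ae (hf0.mono fun x hx => hx l)) inter_subset_right.eventuallyLE
  have huA : ∀ (A : Set X) (hA : IsMassAtom lam A), ⟪u, ind lam hA.1⟫ = 0 := by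
    intro A hA
    have := hub A hA.1
    rw [measureReal_def, hA.inter_null hE hno, ENNReal.toReal_zero, mul_zero] at this
    exact abs_nonpos_iff.1 this
  have hbd : ∀ l : Fin 3,
      (∀ (s : Set X) (hs : MeasurableSet s), s ⊆ E → ε * lam.real s ≤ ψ l (ind lam hs)) →
      ∀ (s : Set X) (hs : MeasurableSet s), |⟪u, ind lam hs⟫| ≤ ψ l (ind lam hs) :=
    fun l hl s hs => (hub s hs).trans ((hl _ (hE.inter hs) inter_subset_left).trans (hmono l s hs))
  have hplus := mem_fiber_of_transfer hmem hjk huh huA (hbd j hj) (hbd k hk)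
  have hminus := mem_fiber_of_transfer hmem hjk.symm huh huA (hbd k hk) (hbd j hj)
  have heq := hψ.2 hplus hminus ⟨1 / 2, 1 / 2, by norm_num, by norm_num, by norm_num, by module⟩
  rw [add_eq_left] at heq
  have hzero : innerDual lam u = 0 := by
    have := congrFun heq j
    rwa [Pi.sub_apply, Pi.single_eq_same, Pi.single_eq_of_ne hjk, sub_zero] at this
  have : ⟪u, u⟫ = 0 := by rw [← innerDual_apply, hzero]; rfl
  exact hu0 (inner_self_eq_zero.1 this)

/-- The moments of a relaxed partition are the moments of a genuine one, of which `Z` and `W` are the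
first two parts. -/
theorem exists_disjoint_sets {ι : Type*} [Finite ι] (h : ι → Lp ℝ 2 lam) {φ : Triple lam}
    (hφ : φ ∈ relaxedPartitions lam) :
    ∃ (Z W : Set X) (hZ : MeasurableSet Z) (hW : MeasurableSet W), Disjoint Z W ∧
      ∀ i, φ 0 (h i) = ⟪ind lam hZ, h i⟫ ∧ φ 1 (h i) = ⟪ind lam hW, h i⟫ := by
  obtain ⟨ψ, hψ⟩ := (isCompact_fiber h φ).extremePoints_nonempty ⟨φ, hφ, fun _ _ => rfl⟩
  obtain ⟨f, hf, hf0, hf1⟩ := exists_densities hψ.1.1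
  have hmeas : ∀ j, Measurable (f j) := fun j => (Lp.stronglyMeasurable (f j)).measurable
  have hnull : ∀ j k, j ≠ k → ∀ n : ℕ,
      lam ({x | 1 / ((n : ℝ) + 1) ≤ f j x} ∩ {x | 1 / ((n : ℝ) + 1) ≤ f k x}) = 0 := by
    intro j k hjk n
    have hm : ∀ l, MeasurableSet {x | 1 / ((n : ℝ) + 1) ≤ f l x} := fun l =>
      measurableSet_le measurable_const (hmeas l)
    have key : ∀ (l : Fin 3) (s : Set X) (hs : MeasurableSet s),
        s ⊆ {x | 1 / ((n : ℝ) + 1) ≤ f l x} → 1 / ((n : ℝ) + 1) * lam.real s ≤ ψ l (ind lam hs) := by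
      intro l s hs hsub
      rw [hf, innerDual_apply, inner_ind_right]
      exact setIntegral_ge_of_const_le_real hs (measure_ne_top _ _) (fun x hx => hsub hx)
        ((Lp.memLp (f l)).integrable one_le_two).integrableOn
    exact null_of_extreme hψ hjk ((hm j).inter (hm k)) (by positivity)
      (fun s hs hsub => key j s hs (hsub.trans inter_subset_left))
      (fun s hs hsub => key k s hs (hsub.trans inter_subset_right))
  have hdich : ∀ᵐ x ∂lam, ∀ j k, j ≠ k → ¬ (0 < f j x ∧ 0 < f k x) := by
    have h2 : ∀ᵐ x ∂lam, ∀ j k, j ≠ k → ∀ n : ℕ,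
        x ∉ {x | 1 / ((n : ℝ) + 1) ≤ f j x} ∩ {x | 1 / ((n : ℝ) + 1) ≤ f k x} := by
      simp only [ae_all_iff]
      exact fun j k hjk n => measure_eq_zero_iff_ae_notMem.1 (hnull j k hjk n)
    filter_upwards [h2] with x hx j k hjk hpos
    obtain ⟨n, hn⟩ := exists_nat_one_div_lt (lt_min hpos.1 hpos.2)
    exact hx j k hjk n ⟨hn.le.trans (min_le_left _ _), hn.le.trans (min_le_right _ _)⟩
  have hZ : MeasurableSet {x | 0 < f 0 x} := measurableSet_lt measurable_const (hmeas 0)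
  have hW' : MeasurableSet {x | 0 < f 1 x} := measurableSet_lt measurable_const (hmeas 1)
  -- Subtracting the first set changes the second by a null set and makes the two truly disjoint.
  have hW : MeasurableSet ({x | 0 < f 1 x} \ {x | 0 < f 0 x}) := hW'.diff hZ
  have hsing : ∀ᵐ x ∂lam, ∀ j, 0 < f j x → f j x = 1 := by
    filter_upwards [hf0, hf1, hdich] with x h0 h1 hd j hj
    rw [← h1, Finset.sum_eq_single j]
    · intro k _ hkj
      exact le_antisymm (not_lt.1 fun hk => hd k j hkj ⟨hk, hj⟩) (h0 k)
    · simp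
  have hf0Z : f 0 = ind lam hZ := by
    refine Lp.ext ?_
    filter_upwards [hf0, hsing, indicatorConstLp_coeFn (p := 2) (hs := hZ)
      (hμs := measure_ne_top lam _) (c := (1 : ℝ))] with x h0 h1 hx
    rw [ind, hx]
    by_cases hx0 : 0 < f 0 x
    · rw [indicator_of_mem (by exact hx0), h1 0 hx0]
    · rw [indicator_of_notMem (by exact hx0), le_antisymm (not_lt.1 hx0) (h0 0)]
  have hf1W : f 1 = ind lam hW := by
    refine Lp.ext ?_
    filter_upwards [hf0, hsing, hdich, indicatorConstLp_coeFn (p := 2) (hs := hW)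
      (hμs := measure_ne_top lam _) (c := (1 : ℝ))] with x h0 h1 hd hx
    rw [ind, hx]
    by_cases hx0 : 0 < f 1 x
    · rw [indicator_of_mem (by exact ⟨hx0, fun hx1 => hd 0 1 (by decide) ⟨hx1, hx0⟩⟩), h1 1 hx0]
    · rw [indicator_of_notMem (by exact fun hx1 => hx0 hx1.1), le_antisymm (not_lt.1 hx0) (h0 1)]
  refine ⟨_, _, hZ, hW, disjoint_sdiff_right, fun i => ⟨?_, ?_⟩⟩
  · rw [← hψ.1.2 i 0, hf, innerDual_apply, ← hf0Z]
  · rw [← hψ.1.2 i 1, hf, innerDual_apply, ← hf1W]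

end Extreme

/-! ### Vector measures -/

section Main

variable {X : Type*} [MeasurableSpace X] {m : ℕ} (μ : Fin m → SignedMeasure X)

/-- The sum of the total variations of the components, a finite measure that dominates them all. -/
noncomputable def refMeasure : Measure X := ∑ i, (μ i).totalVariation

instance : IsFiniteMeasure (refMeasure μ) := by
  have : ∀ i, IsFiniteMeasure (μ i).totalVariation := fun i => by
    rw [SignedMeasure.totalVariation]; infer_instance
  rw [refMeasure]; infer_instance

theorem totalVariation_le_refMeasure (i : Fin m) : (μ i).totalVariation ≤ refMeasure μ := by
  intro s
  rw [refMeasure, Measure.finsetSum_apply]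
  exact Finset.single_le_sum (f := fun i => (μ i).totalVariation s) (fun _ _ => zero_le)
    (Finset.mem_univ i)

theorem val_eq_zero_of_refMeasure_eq_zero {s : Set X} (hs : refMeasure μ s = 0) (i : Fin m) :
    μ i s = 0 :=
  SignedMeasure.null_of_totalVariation_zero _
    (le_antisymm ((totalVariation_le_refMeasure μ i s).trans_eq hs) (zero_le))

theorem exists_rnDeriv_memLp {lam ν : Measure X} [IsFiniteMeasure lam] (hν : ν ≤ lam) :
    ∃ g : X → ℝ, MemLp g 2 lam ∧ ∀ s, ∫ x in s, g x ∂lam = ν.real s := by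
  have : IsFiniteMeasure ν := isFiniteMeasure_of_le lam hν
  refine ⟨fun x => (ν.rnDeriv lam x).toReal, ?_, fun s =>
    Measure.setIntegral_toReal_rnDeriv (Measure.absolutelyContinuous_of_le hν) s⟩
  refine MemLp.of_bound (Measure.measurable_rnDeriv ν lam).ennreal_toReal.aestronglyMeasurable 1 ?_
  filter_upwards [Measure.rnDeriv_le_one_of_le hν] with x hx
  rw [Real.norm_of_nonneg ENNReal.toReal_nonneg]
  exact ENNReal.toReal_le_of_le_ofReal zero_le_one (by simpa using hx)

/-- The components have square integrable, indeed bounded, densities: their positive and negative parts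
lie below the reference measure. -/
theorem exists_inner_ind_eq (i : Fin m) : ∃ h : Lp ℝ 2 (refMeasure μ),
    ∀ (s : Set X) (hs : MeasurableSet s), ⟪ind (refMeasure μ) hs, h⟫ = μ i s := by
  have hle := totalVariation_le_refMeasure μ i
  obtain ⟨g, hg, hgi⟩ := exists_rnDeriv_memLp
    ((Measure.le_add_right (ν' := (μ i).toJordanDecomposition.negPart) le_rfl).trans hle)
  obtain ⟨k, hk, hki⟩ := exists_rnDeriv_memLp
    ((Measure.le_add_left (ν' := (μ i).toJordanDecomposition.posPart) le_rfl).trans hle)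
  refine ⟨(hg.sub hk).toLp _, fun s hs => ?_⟩
  rw [inner_ind, SignedMeasure.apply_eq_posPart_real_sub_negPart_real _ hs, ← hgi, ← hki,
    ← integral_sub (hg.integrable one_le_two).integrableOn (hk.integrable one_le_two).integrableOn]
  exact integral_congr_ae (ae_restrict_of_ae (MemLp.coeFn_toLp _))

variable {μ}

theorem exists_subset_ne_zero {ν : SignedMeasure X} {A : Set X} (hA : MeasurableSet A)
    (h : ν.totalVariation A ≠ 0) : ∃ B ⊆ A, MeasurableSet B ∧ ν B ≠ 0 := by
  by_contra! hB
  obtain ⟨P, hP, hP1, hP2, hpos, hneg⟩ := ν.toJordanDecomposition_spec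
  apply h
  rw [SignedMeasure.totalVariation, Measure.add_apply, hpos, hneg,
    SignedMeasure.toMeasureOfZeroLE_apply _ _ _ hA, SignedMeasure.toMeasureOfLEZero_apply _ _ _ hA]
  have h1 := hB (P ∩ A) inter_subset_right (hP.inter hA)
  have h2 := hB (Pᶜ ∩ A) inter_subset_right (hP.compl.inter hA)
  simp [h1, h2]

theorem Atomless.not_isMassAtom (hμ : Atomless μ) (A : Set X) :
    ¬ IsMassAtom (refMeasure μ) A := by
  rintro ⟨hA, hA0, hatom⟩
  obtain ⟨i, hi⟩ : ∃ i, (μ i).totalVariation A ≠ 0 := by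
    by_contra! h
    apply hA0
    rw [refMeasure, Measure.finsetSum_apply]
    exact Finset.sum_eq_zero fun i _ => h i
  obtain ⟨B, hBA, hB, hB0⟩ := exists_subset_ne_zero hA hi
  obtain ⟨C, hC, hCB, hC0, hC1⟩ := hμ i B hB hB0
  have hCA := hCB.trans hBA
  rcases hatom C hCA hC with h | h
  · exact hC0 (val_eq_zero_of_refMeasure_eq_zero μ h i)
  · apply hC1
    have h1 : refMeasure μ (B \ C) = 0 := by
      refine measure_mono_null (sdiff_subset_sdiff_left hBA) ?_
      rw [measure_sdiff hCA hC.nullMeasurableSet (measure_ne_top _ _), h, tsub_self]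
    have h2 := VectorMeasure.of_add_of_sdiff (v := μ i) hC hB hCB
    rwa [val_eq_zero_of_refMeasure_eq_zero μ h1 i, add_zero] at h2

/-- A measurable subset `Z` of a measurable `Y` is the same as the disjoint pair `(Z, Y \ Z)`. -/
theorem mem_subrange_iff {p q : Fin m → ℝ} : q ∈ subrange μ p ↔
    ∃ Z W : Set X, MeasurableSet Z ∧ MeasurableSet W ∧ Disjoint Z W ∧ val μ Z = q ∧
      val μ Z + val μ W = p := by
  simp only [subrange, level, range, mem_iUnion, mem_ofPred_eq, exists_prop]
  constructor
  · rintro ⟨Y, ⟨hY, rfl⟩, Z, hZ, hZY, rfl⟩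
    exact ⟨Z, Y \ Z, hZ, hY.diff hZ, disjoint_sdiff_right, rfl,
      funext fun i => VectorMeasure.of_add_of_sdiff hZ hY hZY⟩
  · rintro ⟨Z, W, hZ, hW, hd, rfl, rfl⟩
    exact ⟨Z ∪ W, ⟨hZ.union hW, funext fun i => VectorMeasure.of_union hd hZ hW⟩, Z, hZ,
      subset_union_left, rfl⟩

theorem subrange_eq_image {h : Fin m → Lp ℝ 2 (refMeasure μ)}
    (hh : ∀ i (s : Set X) (hs : MeasurableSet s), ⟪ind (refMeasure μ) hs, h i⟫ = μ i s)
    (p : Fin m → ℝ) :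
    subrange μ p = (fun (φ : Triple (refMeasure μ)) i => φ 0 (h i)) ''
      (relaxedPartitions (refMeasure μ) ∩ {φ | ∀ i, φ 0 (h i) + φ 1 (h i) = p i}) := by
  ext q
  rw [mem_subrange_iff]
  constructor
  · rintro ⟨Z, W, hZ, hW, hd, rfl, rfl⟩
    have hs : ∀ j, MeasurableSet ((![Z, W, (Z ∪ W)ᶜ] : Fin 3 → Set X) j) := by
      intro j
      fin_cases j
      exacts [hZ, hW, (hZ.union hW).compl]
    refine ⟨_, ⟨indicator_mem_relaxedPartitions hs ?_ ?_, fun i => ?_⟩, funext fun i => hh i Z hZ⟩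
    · have h1 : Disjoint Z (Z ∪ W)ᶜ := disjoint_compl_right.mono_left subset_union_left
      have h2 : Disjoint W (Z ∪ W)ᶜ := disjoint_compl_right.mono_left subset_union_right
      intro a b hab
      fin_cases a <;> fin_cases b
      exacts [absurd rfl hab, hd, h1, hd.symm, absurd rfl hab, h2, h1.symm, h2.symm,
        absurd rfl hab]
    · rw [eq_univ_iff_forall]
      intro x
      rw [mem_iUnion, Fin.exists_fin_succ, Fin.exists_fin_two]
      by_cases hxZ : x ∈ Z
      · exact Or.inl hxZ
      by_cases hxW : x ∈ W
      · exact Or.inr (Or.inl hxW)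
      · exact Or.inr (Or.inr fun hx => hx.elim hxZ hxW)
    · exact congrArg₂ (· + ·) (hh i Z hZ) (hh i W hW)
  · rintro ⟨φ, ⟨hφ, hp⟩, rfl⟩
    obtain ⟨Z, W, hZ, hW, hd, hZW⟩ := exists_disjoint_sets h hφ
    refine ⟨Z, W, hZ, hW, hd, funext fun i => ?_, funext fun i => ?_⟩
    · exact ((hZW i).1.trans (hh i Z hZ)).symm
    · rw [← hp i, (hZW i).1, (hZW i).2, hh, hh]; rfl

end Main

end VecMeas

theorem theorem1 {X : Type*} [MeasurableSpace X] (m : ℕ) (μ : Fin m → SignedMeasure X) :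
    (∀ p ∈ VecMeas.range μ univ,
      IsCompact (VecMeas.subrange μ p) ∧
      (VecMeas.Atomless μ → Convex ℝ (VecMeas.subrange μ p))) ∧
    VecMeas.subrange μ (VecMeas.val μ univ) = VecMeas.range μ univ := by
  choose h hh using VecMeas.exists_inner_ind_eq μ
  refine ⟨fun p _ => ?_, ?_⟩
  · rw [VecMeas.subrange_eq_image hh p]
    constructor
    · refine IsCompact.image (VecMeas.isCompact_relaxedPartitions.inter_right ?_)
        (continuous_pi fun i => VecMeas.continuous_eval 0 (h i))
      rw [ofPred_forall]
      exact isClosed_iInter fun i => isClosed_eq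
        ((VecMeas.continuous_eval 0 (h i)).add (VecMeas.continuous_eval 1 (h i))) continuous_const
    · intro hμ
      have hlin : IsLinearMap ℝ
          fun (φ : VecMeas.Triple (VecMeas.refMeasure μ)) (i : Fin m) => φ 0 (h i) :=
        ⟨fun _ _ => rfl, fun _ _ => rfl⟩
      refine Convex.is_linear_image ((VecMeas.convex_relaxedPartitions hμ.not_isMassAtom).inter ?_)
        hlin
      intro φ hφ ψ hψ a b _ _ hab i
      change (a * φ 0 (h i) + b * ψ 0 (h i)) + (a * φ 1 (h i) + b * ψ 1 (h i)) = p i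
      linear_combination a * hφ i + b * hψ i + p i * hab
  · refine Subset.antisymm (iUnion₂_subset fun Y _ q hq => ?_) fun q hq => ?_
    · obtain ⟨Z, hZ, -, hq⟩ := hq
      exact ⟨Z, hZ, subset_univ Z, hq⟩
    · exact mem_iUnion₂.2 ⟨univ, ⟨MeasurableSet.univ, rfl⟩, hq⟩
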